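/- Let $X$ be a complex Hilbert space, let $A$ be a bounded linear operator on $X$, let $h\ge 0$, and let $P,Q$ be polynomials with complex coefficients and $\deg P>\deg Q$ (with $\deg 0=-\infty$). Suppose that $A$ is subnormal, with minimal normal extension $N$ on a complex Hilbert space $K$: that is, $X$ is embedded isometrically in $K$, $N$ is a bounded normal operator on $K$ with $N|_X=A$, and for every proper closed subspace $M$ of $K$ with $X\subseteq M$ and $N(M)\subseteq M$ the restriction $N|_M$ is not a normal operator on $M$. Let $\sigma(N)$ be the spectrum of $N$ and let $H(N)$ be the union of the bounded connected components of $\mathbb{C}\setminus\sigma(N)$ (the holes of $\sigma(N)$). Write $\mathbb{C}_+=\{s\in\mathbb{C}:\operatorname{Re}s>0\}$ and $\overline{\mathbb{C}}_+=\{s\in\mathbb{C}:\operatorname{Re}s\ge 0\}$. We say that the function $s\mapsto (P(s)I+Q(s)e^{-sh}A)^{-1}$ belongs to $H^\infty(L(X))$ if $P(s)I+Q(s)e^{-sh}A$ has a bounded inverse for every $s\in\mathbb{C}_+$ and this inverse is an analytic function of $s\in\mathbb{C}_+$, bounded in operator norm on $\mathbb{C}_+$. 1. If $P(s)+\lambda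 Q(s)e^{-sh}\ne 0$ for all $s\in\overline{\mathbb{C}}_+$ and all $\lambda\in\sigma(N)\cup H(N)$, then $(P(s)I+Q(s)e^{-sh}A)^{-1}\in H^\infty(L(X))$. 2. Conversely, if $(P(s)I+Q(s)e^{-sh}A)^{-1}\in H^\infty(L(X))$, then $P(s)+\lambda Q(s)e^{-sh}\ne 0$ for all $s\in\overline{\mathbb{C}}_+$ and all $\lambda\in\sigma(N)$. -/

import Mathlib

open Polynomial

/-- The open right half-plane. -/
def openRightHalfPlane : Set ℂ := {s : ℂ | 0 < s.re}

/-- The closed right half-plane. -/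
def closedRightHalfPlane : Set ℂ := {s : ℂ | 0 ≤ s.re}

/-- Membership in `H^∞(B)`: `F` is a bounded analytic `B`-valued function on the open right
half-plane. -/
def MemHInfty {B : Type*} [NormedAddCommGroup B] [NormedSpace ℂ B] (F : ℂ → B) : Prop :=
  DifferentiableOn ℂ F openRightHalfPlane ∧
    ∃ C : ℝ, ∀ s ∈ openRightHalfPlane, ‖F s‖ ≤ C

/-- The scalar function `P(s) + λ Q(s) e^{-sh}`. -/
noncomputable def scalarSymbol (P Q : ℂ[X]) (h : ℝ) (l s : ℂ) : ℂ :=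
  P.eval s + l * Q.eval s * Complex.exp (-(s * (h : ℂ)))

/-- The operator-valued function `P(s) I + Q(s) e^{-sh} A`. -/
noncomputable def operatorSymbol {X : Type*} [NormedAddCommGroup X] [NormedSpace ℂ X]
    (P Q : ℂ[X]) (h : ℝ) (A : X →L[ℂ] X) (s : ℂ) : X →L[ℂ] X :=
  P.eval s • (1 : X →L[ℂ] X) + (Q.eval s * Complex.exp (-(s * (h : ℂ)))) • A

/-- The transfer function `(P(s) I + Q(s) e^{-sh} A)⁻¹` belongs to `H^∞(L(X))`: the operators are
invertible (in the algebra of bounded operators) at every point of the open right half-plane, and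
the inverse is a bounded analytic function there. -/
def TransferMemHInfty {X : Type*} [NormedAddCommGroup X] [NormedSpace ℂ X]
    (P Q : ℂ[X]) (h : ℝ) (A : X →L[ℂ] X) : Prop :=
  (∀ s ∈ openRightHalfPlane, IsUnit (operatorSymbol P Q h A s)) ∧
    MemHInfty (fun s => Ring.inverse (operatorSymbol P Q h A s))

/-- The holes of a set `S ⊆ ℂ`: the union of the bounded connected components of the complement
of `S`. -/
def holes (S : Set ℂ) : Set ℂ :=
  {z : ℂ | z ∈ Sᶜ ∧ Bornology.IsBounded (connectedComponentIn Sᶜ z)}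

section NormalExtension

variable {X : Type*} [NormedAddCommGroup X] [InnerProductSpace ℂ X]
variable {K : Type*} [NormedAddCommGroup K] [InnerProductSpace ℂ K] [CompleteSpace K]

/-- `N` is a normal extension of `A`, where `X` is regarded as a subspace of `K` through the
linear isometry `J`. An operator `A` for which such `K`, `J`, `N` exist is called subnormal. -/
structure IsNormalExtension (A : X →L[ℂ] X) (J : X →ₗᵢ[ℂ] K) (N : K →L[ℂ] K) : Prop where
  normal : IsStarNormal N
  extends_apply : ∀ x : X, N (J x) = J (A x)

/-- `N` is a minimal normal extension of `A`: a normal extension such that no restriction of `N`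
to a proper closed invariant subspace (a Hilbert space in its own right) containing `X` is
normal. -/
structure IsMinimalNormalExtension (A : X →L[ℂ] X) (J : X →ₗᵢ[ℂ] K) (N : K →L[ℂ] K) : Prop
    extends IsNormalExtension A J N where
  minimal : ∀ (M : Submodule ℂ K) [CompleteSpace M] (hM : ∀ x ∈ M, N x ∈ M),
    (∀ x : X, J x ∈ M) → IsStarNormal (N.restrict hM : M →L[ℂ] M) → M = ⊤

end NormalExtension

open Filter Topology Bornology

/-! ### Lower bounds and perturbation of inverses. -/

section Inverse

/-! The symbol is affine in `A`, so it is invertible at `s` when the scalar symbol has no zero `l`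
in `σ(A)`. Two facts then suffice. Spectral: `σ(N) ⊆ σ(A) ⊆ σ(N) ∪ holes`. The first inclusion uses
minimality and a bump function of `N`; the second holds because a boundary point of `σ(A)` cannot be
a regular point of `N`. Analytic: the transfer function is in `H^∞` exactly when the symbol is
invertible on the closed half-plane. Compactness and the growth of `P` over `Q` give one direction;
stability of units under small perturbation gives the other. -/

theorem isUnit_of_norm_inverse_mul_norm_sub_lt_one {R : Type*} [NormedRing R]
    [HasSummableGeomSeries R] {a b : R} (hb : IsUnit b)
    (hab : ‖Ring.inverse b‖ * ‖b - a‖ < 1) : IsUnit a := by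
  have h1 : IsUnit (1 - Ring.inverse b * (b - a)) :=
    isUnit_one_sub_of_norm_lt_one ((norm_mul_le _ _).trans_lt hab)
  have h2 : a = b * (1 - Ring.inverse b * (b - a)) := by
    rw [mul_sub, ← mul_assoc, Ring.mul_inverse_cancel b hb]
    simp
  rw [h2]
  exact hb.mul h1

variable {X : Type*} [NormedAddCommGroup X] [NormedSpace ℂ X]

theorem ContinuousLinearMap.norm_inverse_le_of_bounded_below {T : X →L[ℂ] X} (hT : IsUnit T)
    {c : ℝ} (hc : 0 < c) (hb : ∀ x, c * ‖x‖ ≤ ‖T x‖) : ‖Ring.inverse T‖ ≤ c⁻¹ := by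
  refine ContinuousLinearMap.opNorm_le_bound _ (inv_nonneg.2 hc.le) fun y => ?_
  have h1 := hb (Ring.inverse T y)
  have h2 : T (Ring.inverse T y) = y := by
    rw [← mul_apply_eq_comp, Ring.mul_inverse_cancel T hT]
    rfl
  rw [h2] at h1
  rwa [le_inv_mul_iff₀ hc]

/-- The lower bound passes from `T` to `S` with constant `2c/3`, so `‖S⁻¹‖ ‖S - T‖ ≤ 1/2`. -/
theorem ContinuousLinearMap.isUnit_of_bounded_below_of_near [CompleteSpace X] {T S : X →L[ℂ] X}
    {c : ℝ} (hc : 0 < c) (hb : ∀ x, c * ‖x‖ ≤ ‖T x‖) (hS : IsUnit S) (hTS : ‖S - T‖ ≤ c / 3) :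
    IsUnit T := by
  have hS' : ∀ x, (2 * c / 3) * ‖x‖ ≤ ‖S x‖ := fun x => by
    have h1 : ‖(S - T) x‖ ≤ c / 3 * ‖x‖ :=
      (ContinuousLinearMap.le_opNorm _ _).trans (by gcongr)
    have h2 : ‖T x‖ ≤ ‖S x‖ + ‖(S - T) x‖ := by
      have : T x = S x - (S - T) x := by simp
      rw [this]
      exact norm_sub_le _ _
    have := hb x
    linarith
  have h3 := ContinuousLinearMap.norm_inverse_le_of_bounded_below hS (by positivity) hS'
  refine isUnit_of_norm_inverse_mul_norm_sub_lt_one hS ?_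
  calc ‖Ring.inverse S‖ * ‖S - T‖ ≤ (2 * c / 3)⁻¹ * (c / 3) := by gcongr
    _ = 1 / 2 := by field_simp
    _ < 1 := by norm_num

theorem ContinuousLinearMap.exists_bounded_below_of_isUnit {T : X →L[ℂ] X} (hT : IsUnit T) :
    ∃ c > 0, ∀ x, c * ‖x‖ ≤ ‖T x‖ := by
  refine ⟨(‖Ring.inverse T‖ + 1)⁻¹, by positivity, fun x => ?_⟩
  rw [inv_mul_le_iff₀ (by positivity)]
  have h1 : Ring.inverse T (T x) = x := by
    rw [← mul_apply_eq_comp, Ring.inverse_mul_cancel T hT]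
    rfl
  calc ‖x‖ = ‖Ring.inverse T (T x)‖ := by rw [h1]
    _ ≤ ‖Ring.inverse T‖ * ‖T x‖ := ContinuousLinearMap.le_opNorm _ _
    _ ≤ _ := by gcongr; linarith

end Inverse

section Restriction

variable {K : Type*} [NormedAddCommGroup K] [InnerProductSpace ℂ K] [CompleteSpace K]

theorem ContinuousLinearMap.isStarNormal_restrict {N : K →L[ℂ] K} (hN : IsStarNormal N)
    {M : Submodule ℂ K} [CompleteSpace M] (hM : ∀ x ∈ M, N x ∈ M)
    (hM' : ∀ x ∈ M, star N x ∈ M) : IsStarNormal (N.restrict hM : M →L[ℂ] M) := by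
  have h1 : star (N.restrict hM : M →L[ℂ] M) = (star N).restrict hM' := by
    symm
    refine (ContinuousLinearMap.eq_adjoint_iff _ _).2 fun x y => ?_
    simp only [Submodule.coe_inner, ContinuousLinearMap.coe_restrict_apply,
      ContinuousLinearMap.star_eq_adjoint]
    exact ContinuousLinearMap.adjoint_inner_left N _ _
  refine ⟨?_⟩
  rw [h1]
  ext x
  exact DFunLike.congr_fun hN.star_comm_self.eq (x : K)

end Restriction

/-! ### Comparison of the spectra of `A` and `N`. -/

section SpectralInclusion

variable {X : Type*} [NormedAddCommGroup X] [InnerProductSpace ℂ X]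
variable {K : Type*} [NormedAddCommGroup K] [InnerProductSpace ℂ K] [CompleteSpace K]
variable {A : X →L[ℂ] X} {J : X →ₗᵢ[ℂ] K} {N : K →L[ℂ] K}

/-- If `φ(N)` vanishes on the embedded subspace, then it vanishes. -/
theorem IsMinimalNormalExtension.cfc_eq_zero (hN : IsMinimalNormalExtension A J N) (φ : ℂ → ℂ)
    (hφ : ∀ x, cfc φ N (J x) = 0) : cfc φ N = 0 := by
  have hn := hN.normal
  -- The kernel of `φ(N)` reduces `N`, since `φ(N)` commutes with `N` and `star N`; minimality makes
  -- it all of `K`.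
  have key : ∀ B : K →L[ℂ] K, Commute (cfc φ N) B →
      ∀ x ∈ (cfc φ N).ker, B x ∈ (cfc φ N).ker := by
    intro B hB x hx
    have h1 := DFunLike.congr_fun hB.eq x
    simp only [mul_apply_eq_comp] at h1
    rw [LinearMap.mem_ker] at hx ⊢
    erw [h1]
    erw [hx]
    simp
  have hc1 : Commute (cfc φ N) N := (Commute.cfc (Commute.refl N) hn.star_comm_self φ)
  have hc2 : Commute (cfc φ N) (star N) :=
    (Commute.cfc hn.star_comm_self.symm (Commute.refl _) φ)
  have : CompleteSpace (cfc φ N).ker :=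
    (ContinuousLinearMap.isClosed_ker (cfc φ N)).completeSpace_coe
  have htop := hN.minimal (cfc φ N).ker (key N hc1) (fun x => hφ x)
    (ContinuousLinearMap.isStarNormal_restrict hn _ (key _ hc2))
  ext x
  have : x ∈ (cfc φ N).ker := htop ▸ Submodule.mem_top
  exact this

/-- The spectral inclusion theorem. -/
theorem IsMinimalNormalExtension.spectrum_subset (hN : IsMinimalNormalExtension A J N) :
    spectrum ℂ N ⊆ spectrum ℂ A := by
  intro l hl hres
  have hn := hN.normal
  have hunit : IsUnit (A - algebraMap ℂ (X →L[ℂ] X) l) := by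
    have : IsUnit (algebraMap ℂ (X →L[ℂ] X) l - A) := hres
    simpa using this.neg
  set B := A - algebraMap ℂ (X →L[ℂ] X) l with hB
  set r := ‖Ring.inverse B‖ with hr
  have hr0 : 0 ≤ r := norm_nonneg _
  -- Chosen so that `ε * r ≤ 1/2`; `φ` is a tent of height 1 at `l`, vanishing outside the `ε`-disc.
  set ε : ℝ := (2 * (r + 1))⁻¹ with hε
  have hε0 : 0 < ε := by positivity
  set φ : ℂ → ℂ := fun z => ((max 0 (1 - ‖z - l‖ / ε) : ℝ) : ℂ) with hφ
  have hφc : Continuous φ := by fun_prop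
  have hbound : ∀ n : ℕ, ‖cfc φ N * (N - algebraMap ℂ (K →L[ℂ] K) l) ^ n‖ ≤ ε ^ n := by
    intro n
    have h1 : N - algebraMap ℂ (K →L[ℂ] K) l = cfc (fun z => z - l) N := by
      rw [cfc_sub (fun z => z) (fun _ => l) N, cfc_id' ℂ N, cfc_const l N]
    rw [h1, ← cfc_pow (fun z => z - l) n N, ← cfc_mul φ (fun z => (z - l) ^ n) N]
    refine norm_cfc_le (by positivity) fun z _ => ?_
    rw [norm_mul, norm_pow, hφ]
    simp only [Complex.norm_real, Real.norm_eq_abs]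
    rw [abs_of_nonneg (le_max_left _ _)]
    rcases le_total ‖z - l‖ ε with h2 | h2
    · have h3 : max 0 (1 - ‖z - l‖ / ε) ≤ 1 := max_le zero_le_one (by
        have : 0 ≤ ‖z - l‖ / ε := by positivity
        linarith)
      calc _ ≤ 1 * ε ^ n := by gcongr
        _ = _ := one_mul _
    · have h3 : max 0 (1 - ‖z - l‖ / ε) = 0 := max_eq_left (by
        have : 1 ≤ ‖z - l‖ / ε := (one_le_div hε0).2 h2
        linarith)
      rw [h3, zero_mul]
      positivity
  have hpow : ∀ (n : ℕ) (x : X), ((N - algebraMap ℂ (K →L[ℂ] K) l) ^ n) (J x) = J ((B ^ n) x) := by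
    intro n
    induction n with
    | zero => simp
    | succ n ih =>
      intro x
      rw [pow_succ, pow_succ, mul_apply_eq_comp, mul_apply_eq_comp, ← ih]
      congr 1
      simp [hB, hN.extends_apply, Algebra.algebraMap_eq_smul_one]
  have hvanish : ∀ x, cfc φ N (J x) = 0 := by
    intro x
    have hle : ∀ n : ℕ, ‖cfc φ N (J x)‖ ≤ (1 / 2) ^ n * ‖x‖ := by
      intro n
      have h1 : (B ^ n) ((Ring.inverse B ^ n) x) = x := by
        rw [← mul_apply_eq_comp]
        have hcomm : Commute B (Ring.inverse B) := by
          rw [commute_iff_eq, Ring.mul_inverse_cancel B hunit, Ring.inverse_mul_cancel B hunit]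
        rw [← hcomm.mul_pow, Ring.mul_inverse_cancel B hunit]
        simp
      -- Write `J x = (N - l)^n J (B⁻ⁿ x)`: the factor `ε ^ n` beats the growth `r ^ n`.
      have h2 : cfc φ N (J x) =
          (cfc φ N * (N - algebraMap ℂ (K →L[ℂ] K) l) ^ n) (J ((Ring.inverse B ^ n) x)) := by
        rw [mul_apply_eq_comp, hpow, h1]
      have h3 : ‖(Ring.inverse B ^ n) x‖ ≤ r ^ n * ‖x‖ := by
        clear h1 h2
        induction n with
        | zero => simp
        | succ n ih =>
          rw [pow_succ', mul_apply_eq_comp]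
          calc _ ≤ r * ‖(Ring.inverse B ^ n) x‖ := ContinuousLinearMap.le_opNorm _ _
            _ ≤ r * (r ^ n * ‖x‖) := by gcongr
            _ = _ := by ring
      have h4 : ε * r ≤ 1 / 2 := by
        rw [hε, inv_mul_le_iff₀ (by positivity)]
        linarith
      calc ‖cfc φ N (J x)‖ ≤ ε ^ n * ‖J ((Ring.inverse B ^ n) x)‖ := by
            rw [h2]
            exact (ContinuousLinearMap.le_opNorm _ _).trans (by gcongr; exact hbound n)
        _ ≤ ε ^ n * (r ^ n * ‖x‖) := by rw [J.norm_map]; gcongr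
        _ = (ε * r) ^ n * ‖x‖ := by ring
        _ ≤ _ := by gcongr
    have hlim : Tendsto (fun n : ℕ => (1 / 2 : ℝ) ^ n * ‖x‖) atTop (𝓝 0) := by
      simpa using (tendsto_pow_atTop_nhds_zero_of_lt_one (by norm_num : (0 : ℝ) ≤ 1 / 2)
        (by norm_num)).mul_const ‖x‖
    exact norm_le_zero_iff.1 (ge_of_tendsto' hlim hle)
  have hzero := hN.cfc_eq_zero φ hvanish
  have h1 : (1 : ℂ) ∈ spectrum ℂ (cfc φ N) := by
    rw [cfc_map_spectrum φ N]
    exact ⟨l, hl, by simp [hφ]⟩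
  rw [hzero] at h1
  have : Nontrivial (K →L[ℂ] K) := by
    by_contra hK
    rw [not_nontrivial_iff_subsingleton] at hK
    simp [spectrum.of_subsingleton] at hl
  rw [spectrum.zero_eq] at h1
  simp at h1

variable [CompleteSpace X]

/-- Off `σ(N)` the operator `z - N` is bounded below, hence so is `z - A`. If resolvent points of
`A` accumulated at `z`, then `z - A` would be invertible. -/
theorem IsNormalExtension.mem_interior_spectrum (hN : IsNormalExtension A J N) {z : ℂ}
    (hz : z ∈ spectrum ℂ A) (hz' : z ∉ spectrum ℂ N) : z ∈ interior (spectrum ℂ A) := by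
  by_contra hint
  have hNu : IsUnit (algebraMap ℂ (K →L[ℂ] K) z - N) := by simpa [spectrum.mem_iff] using hz'
  obtain ⟨c, hc, hb⟩ := ContinuousLinearMap.exists_bounded_below_of_isUnit hNu
  have hbA : ∀ x, c * ‖x‖ ≤ ‖(algebraMap ℂ (X →L[ℂ] X) z - A) x‖ := fun x => by
    have h1 := hb (J x)
    have h2 : (algebraMap ℂ (K →L[ℂ] K) z - N) (J x) =
        J ((algebraMap ℂ (X →L[ℂ] X) z - A) x) := by
      simp [hN.extends_apply, Algebra.algebraMap_eq_smul_one]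
    rwa [h2, J.norm_map, J.norm_map] at h1
  have hcl : z ∈ closure (spectrum ℂ A)ᶜ := by
    rwa [closure_compl]
  obtain ⟨w, hw, hwz⟩ := Metric.mem_closure_iff.1 hcl (c / 3) (by positivity)
  have hwu : IsUnit (algebraMap ℂ (X →L[ℂ] X) w - A) := by simpa [spectrum.mem_iff] using hw
  refine hz (ContinuousLinearMap.isUnit_of_bounded_below_of_near hc hbA hwu ?_)
  have h3 : algebraMap ℂ (X →L[ℂ] X) w - A - (algebraMap ℂ (X →L[ℂ] X) z - A) =
      (w - z) • (1 : X →L[ℂ] X) := by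
    rw [Algebra.algebraMap_eq_smul_one, Algebra.algebraMap_eq_smul_one, sub_smul]
    abel
  rw [h3, norm_smul, ← dist_eq_norm, dist_comm]
  calc dist z w * ‖(1 : X →L[ℂ] X)‖ ≤ dist z w * 1 := by
        gcongr
        exact ContinuousLinearMap.norm_id_le
    _ ≤ c / 3 := by linarith

theorem IsNormalExtension.spectrum_subset_union_holes (hN : IsNormalExtension A J N) :
    spectrum ℂ A ⊆ spectrum ℂ N ∪ holes (spectrum ℂ N) := by
  intro z hz
  by_cases hz' : z ∈ spectrum ℂ N
  · exact Or.inl hz'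
  refine Or.inr ⟨hz', ?_⟩
  -- Within the complement of `σ(N)` the interior of `σ(A)` is relatively clopen, so it swallows the
  -- component of `z`.
  have hsub : connectedComponentIn (spectrum ℂ N)ᶜ z ⊆ interior (spectrum ℂ A) := by
    refine isPreconnected_connectedComponentIn.subset_of_closure_inter_subset isOpen_interior
      ⟨z, mem_connectedComponentIn hz', hN.mem_interior_spectrum hz hz'⟩ ?_
    rintro w ⟨hw, hw'⟩
    exact hN.mem_interior_spectrum
      (closure_minimal interior_subset (spectrum.isClosed A) hw)
      (connectedComponentIn_subset _ _ hw')
  exact (spectrum.isBounded A).subset (hsub.trans interior_subset)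

end SpectralInclusion

/-! ### Growth of polynomials at infinity. -/

section Growth

theorem Polynomial.tendsto_eval_div_pow_cobounded (p : ℂ[X]) {n : ℕ} (hp : p.natDegree ≤ n) :
    Tendsto (fun s => p.eval s / s ^ n) (cobounded ℂ) (𝓝 (p.coeff n)) := by
  have h1 : Tendsto (fun s : ℂ => (reflect n p).eval s⁻¹) (cobounded ℂ)
      (𝓝 ((reflect n p).eval 0)) :=
    ((reflect n p).continuous.tendsto 0).comp tendsto_inv₀_cobounded
  have h2 : (reflect n p).eval 0 = p.coeff n := by
    rw [← coeff_zero_eq_eval_zero, coeff_reflect]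
    simp
  rw [h2] at h1
  refine h1.congr' ?_
  filter_upwards [eventually_ne_cobounded (0 : ℂ)] with s hs
  let _ := invertibleOfNonzero hs
  have h3 := eval₂_reflect_mul_pow (RingHom.id ℂ) s n p hp
  rw [invOf_eq_inv] at h3
  rw [eq_div_iff (pow_ne_zero n hs)]
  exact h3

theorem Polynomial.exists_pos_forall_le_norm_eval_sub (P Q : ℂ[X]) (hdeg : Q.degree < P.degree)
    (M : ℝ) : ∃ m > 0, ∃ R, ∀ s : ℂ, R ≤ ‖s‖ → m ≤ ‖P.eval s‖ - M * ‖Q.eval s‖ := by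
  have hP0 : P ≠ 0 := by
    rintro rfl
    simp at hdeg
  have hQ : Q.natDegree ≤ P.natDegree := natDegree_le_natDegree hdeg.le
  have hc : Q.coeff P.natDegree = 0 :=
    coeff_eq_zero_of_degree_lt (by rwa [← degree_eq_natDegree hP0])
  have h1 := (P.tendsto_eval_div_pow_cobounded le_rfl).norm.sub
    ((Q.tendsto_eval_div_pow_cobounded hQ).norm.const_mul M)
  rw [hc, norm_zero, mul_zero, sub_zero] at h1
  have hl : 0 < ‖P.coeff P.natDegree‖ := by simpa using hP0
  have h2 := h1.eventually_const_le (half_lt_self hl)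
  obtain ⟨R, -, hR⟩ := (hasBasis_cobounded_norm (E := ℂ)).eventually_iff.1 h2
  -- Radius at least 1 lets the power of `‖s‖` be dropped from the lower bound.
  refine ⟨_, half_pos hl, max R 1, fun s hs => ?_⟩
  have h3 := hR (x := s) ((le_max_left _ _).trans hs)
  have hs1 : 1 ≤ ‖s‖ := (le_max_right _ _).trans hs
  have h4 : 1 ≤ ‖s‖ ^ P.natDegree := one_le_pow₀ hs1
  have h5 : 0 < ‖s‖ ^ P.natDegree := by positivity
  simp only [norm_div, norm_pow] at h3
  rw [← mul_div_assoc, ← sub_div, le_div_iff₀ h5] at h3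
  exact (le_mul_of_one_le_right (by positivity) h4).trans h3

end Growth

/-! ### Invertibility of the symbol and `H^∞`. -/

section Symbol

variable {X : Type*} [NormedAddCommGroup X] [NormedSpace ℂ X]
variable (P Q : ℂ[X]) (h : ℝ) (A : X →L[ℂ] X)

theorem differentiable_operatorSymbol : Differentiable ℂ (operatorSymbol P Q h A) := by
  unfold operatorSymbol
  have := P.differentiable
  have := Q.differentiable
  fun_prop

theorem isUnit_operatorSymbol_iff {s : ℂ} (hs : Q.eval s * Complex.exp (-(s * (h : ℂ))) ≠ 0) :
    IsUnit (operatorSymbol P Q h A s) ↔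
      -(P.eval s / (Q.eval s * Complex.exp (-(s * (h : ℂ))))) ∉ spectrum ℂ A := by
  set c := Q.eval s * Complex.exp (-(s * (h : ℂ))) with hc
  have h1 : operatorSymbol P Q h A s =
      -(c • (algebraMap ℂ (X →L[ℂ] X) (-(P.eval s / c)) - A)) := by
    unfold operatorSymbol
    rw [Algebra.algebraMap_eq_smul_one, smul_sub, smul_smul, mul_neg, mul_div_cancel₀ _ hs,
      neg_smul, ← hc]
    abel
  rw [spectrum.mem_iff, not_not, h1, IsUnit.neg_iff]
  exact isUnit_smul_iff (Units.mk0 c hs) _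

variable {P Q h A}

theorem isUnit_operatorSymbol_of_scalarSymbol_ne_zero {s : ℂ} (hne : (spectrum ℂ A).Nonempty)
    (hs : ∀ l ∈ spectrum ℂ A, scalarSymbol P Q h l s ≠ 0) :
    IsUnit (operatorSymbol P Q h A s) := by
  by_cases hc : Q.eval s * Complex.exp (-(s * (h : ℂ))) = 0
  -- With no `A` term left, some `l` is still needed to extract `P(s) ≠ 0`.
  · obtain ⟨l, hl⟩ := hne
    have hP : P.eval s ≠ 0 := by
      have := hs l hl
      rwa [scalarSymbol, mul_assoc, hc, mul_zero, add_zero] at this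
    rw [operatorSymbol, hc, zero_smul, add_zero]
    exact (isUnit_smul_iff (Units.mk0 _ hP) _).2 isUnit_one
  · rw [isUnit_operatorSymbol_iff P Q h A hc]
    refine fun hl => hs _ hl ?_
    rw [scalarSymbol, mul_assoc]
    rw [neg_mul, div_mul_cancel₀ _ hc, add_neg_cancel]

theorem scalarSymbol_ne_zero_of_isUnit_operatorSymbol {s l : ℂ}
    (hs : IsUnit (operatorSymbol P Q h A s)) (hl : l ∈ spectrum ℂ A) :
    scalarSymbol P Q h l s ≠ 0 := by
  intro h0
  rw [scalarSymbol, mul_assoc] at h0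
  by_cases hc : Q.eval s * Complex.exp (-(s * (h : ℂ))) = 0
  · rw [hc, mul_zero, add_zero] at h0
    rw [operatorSymbol, hc, h0, zero_smul, zero_smul, add_zero] at hs
    have : Subsingleton (X →L[ℂ] X) := isUnit_zero_iff.1 hs |> subsingleton_of_zero_eq_one
    simp [spectrum.of_subsingleton] at hl
  · rw [isUnit_operatorSymbol_iff P Q h A hc] at hs
    refine hs ?_
    convert hl using 1
    rw [neg_eq_iff_eq_neg, div_eq_iff hc]
    linear_combination h0

theorem norm_exp_neg_mul_le_one (hh : 0 ≤ h) {s : ℂ} (hs : s ∈ closedRightHalfPlane) :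
    ‖Complex.exp (-(s * (h : ℂ)))‖ ≤ 1 := by
  rw [Complex.norm_exp, Real.exp_le_one_iff]
  have : 0 ≤ s.re * h := mul_nonneg hs hh
  simpa using this

theorem openRightHalfPlane_subset_closedRightHalfPlane :
    openRightHalfPlane ⊆ closedRightHalfPlane := fun s (hs : 0 < s.re) => hs.le

theorem closedRightHalfPlane_subset_closure :
    closedRightHalfPlane ⊆ closure openRightHalfPlane := by
  intro s hs
  have h1 : closure openRightHalfPlane = {z : ℂ | 0 ≤ z.re} := Complex.closure_setOfPred_lt_re 0
  rwa [h1]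

variable [CompleteSpace X]

/-- Invertibility on the closed half-plane gives a bounded analytic inverse, by compactness and
the growth of `P` relative to `Q`. -/
theorem transferMemHInfty_of_isUnit (hh : 0 ≤ h) (hdeg : Q.degree < P.degree)
    (hu : ∀ s ∈ closedRightHalfPlane, IsUnit (operatorSymbol P Q h A s)) :
    TransferMemHInfty P Q h A := by
  have hd := differentiable_operatorSymbol P Q h A
  refine ⟨fun s hs => hu s (openRightHalfPlane_subset_closedRightHalfPlane hs),
    fun s hs => ?_, ?_⟩
  · exact ((differentiableAt_inverse (𝕜 := ℂ)
      (hu s (openRightHalfPlane_subset_closedRightHalfPlane hs))).comp s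
        (hd s)).differentiableWithinAt
  obtain ⟨m, hm, R, hR⟩ := P.exists_pos_forall_le_norm_eval_sub Q hdeg ‖A‖
  have hclosed : IsClosed closedRightHalfPlane := isClosed_le continuous_const Complex.continuous_re
  have hcpt : IsCompact (closedRightHalfPlane ∩ Metric.closedBall 0 R) :=
    (isCompact_closedBall 0 R).inter_left hclosed
  have hcont : ContinuousOn (fun s => Ring.inverse (operatorSymbol P Q h A s))
      (closedRightHalfPlane ∩ Metric.closedBall 0 R) := fun s hs =>
    ((differentiableAt_inverse (𝕜 := ℂ) (hu s hs.1)).comp s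
      (hd s)).continuousAt.continuousWithinAt
  obtain ⟨C, hC⟩ := hcpt.exists_bound_of_continuousOn hcont
  refine ⟨max C m⁻¹, fun s hs => ?_⟩
  have hs' := openRightHalfPlane_subset_closedRightHalfPlane hs
  rcases le_total ‖s‖ R with hsR | hsR
  · exact (hC s ⟨hs', by simpa using hsR⟩).trans (le_max_left _ _)
  refine le_trans ?_ (le_max_right _ _)
  refine ContinuousLinearMap.norm_inverse_le_of_bounded_below (hu s hs') hm fun x => ?_
  have h1 : operatorSymbol P Q h A s x =
      P.eval s • x + (Q.eval s * Complex.exp (-(s * (h : ℂ)))) • A x := by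
    simp [operatorSymbol]
  have h2 : ‖(Q.eval s * Complex.exp (-(s * (h : ℂ)))) • A x‖ ≤ ‖A‖ * ‖Q.eval s‖ * ‖x‖ := by
    rw [norm_smul, norm_mul]
    calc _ ≤ ‖Q.eval s‖ * 1 * (‖A‖ * ‖x‖) := by
          gcongr
          · exact norm_exp_neg_mul_le_one hh hs'
          · exact A.le_opNorm x
      _ = _ := by ring
  have h3 := norm_sub_le_norm_add (P.eval s • x)
    ((Q.eval s * Complex.exp (-(s * (h : ℂ)))) • A x)
  rw [norm_smul (P.eval s)] at h3
  have h4 := mul_le_mul_of_nonneg_right (hR s hsR) (norm_nonneg x)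
  rw [sub_mul] at h4
  rw [h1]
  linarith

/-- Boundedness of the inverse on the open half-plane gives invertibility on the closed one. -/
theorem TransferMemHInfty.isUnit_operatorSymbol (hT : TransferMemHInfty P Q h A) {s : ℂ}
    (hs : s ∈ closedRightHalfPlane) : IsUnit (operatorSymbol P Q h A s) := by
  obtain ⟨hu, -, C, hC⟩ := hT
  have hpos : 0 < |C| + 1 := by positivity
  obtain ⟨δ, hδ, hδ'⟩ := Metric.continuousAt_iff.1
    ((differentiable_operatorSymbol P Q h A).continuous.continuousAt (x := s)) (|C| + 1)⁻¹
    (by positivity)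
  obtain ⟨w, hw, hsw⟩ :=
    Metric.mem_closure_iff.1 (closedRightHalfPlane_subset_closure hs) δ hδ
  have h1 := hδ' (x := w) (by rwa [dist_comm])
  rw [dist_eq_norm] at h1
  refine isUnit_of_norm_inverse_mul_norm_sub_lt_one (hu w hw) ?_
  calc _ ≤ (|C| + 1) * ‖operatorSymbol P Q h A w - operatorSymbol P Q h A s‖ := by
        gcongr
        exact (hC w hw).trans ((le_abs_self C).trans (by linarith))
    _ < (|C| + 1) * (|C| + 1)⁻¹ := by gcongr
    _ = 1 := mul_inv_cancel₀ hpos.ne'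

end Symbol

theorem mainTheorem5
    {X : Type*} [NormedAddCommGroup X] [InnerProductSpace ℂ X] [CompleteSpace X]
    {K : Type*} [NormedAddCommGroup K] [InnerProductSpace ℂ K] [CompleteSpace K]
    (A : X →L[ℂ] X) (J : X →ₗᵢ[ℂ] K) (N : K →L[ℂ] K)
    (hN : IsMinimalNormalExtension A J N)
    (h : ℝ) (hh : 0 ≤ h) (P Q : ℂ[X]) (hdeg : Q.degree < P.degree) :
    ((∀ l ∈ spectrum ℂ N ∪ holes (spectrum ℂ N), ∀ s ∈ closedRightHalfPlane,
        scalarSymbol P Q h l s ≠ 0) →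
      TransferMemHInfty P Q h A) ∧
    (TransferMemHInfty P Q h A →
      ∀ l ∈ spectrum ℂ N, ∀ s ∈ closedRightHalfPlane, scalarSymbol P Q h l s ≠ 0) := by
  refine ⟨fun hs => transferMemHInfty_of_isUnit hh hdeg fun s hsmem => ?_, fun hT l hl s hs =>
    scalarSymbol_ne_zero_of_isUnit_operatorSymbol (hT.isUnit_operatorSymbol hs)
      (hN.spectrum_subset hl)⟩
  -- The spectrum of `A` is empty when `X` is trivial.
  rcases subsingleton_or_nontrivial X with hX | hX
  · exact isUnit_of_subsingleton _
  · exact isUnit_operatorSymbol_of_scalarSymbol_ne_zero (spectrum.nonempty A) fun l hl =>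
      hs l (hN.spectrum_subset_union_holes hl) s hsmem
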